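/- Let $N\ge 1$ be an integer, $p>1$, $0<s<1$ with $ps<N$, and put $p^*:=\frac{Np}{N-ps}$. For measurable $u:\mathbb R^N\to\mathbb R$ let $$[u]_{s,p}:=\Big(\int_{\mathbb R^N\times\mathbb R^N}\frac{|u(x)-u(y)|^p}{|x-y|^{N+ps}}\,dx\,dy\Big)^{1/p},$$ and let $\dot W^{s,p}(\mathbb R^N)$ be the space of measurable $u$ with $[u]_{s,p}<\infty$ and $|\{|u|>a\}|<\infty$ for all $a>0$. Let $(-\Delta_p)^s u$ denote the differential at $u$ of the functional $v\mapsto\frac1p[v]_{s,p}^p$ on $\dot W^{s,p}(\mathbb R^N)$. For $f\in L^1_{\rm loc}(\mathbb R^N)$, a function $u\in\dot W^{s,p}(\mathbb R^N)$ is called a weak solution of $(-\Delta_p)^su=f$ in $\mathbb R^N$ if $\langle(-\Delta_p)^su,\varphi\rangle=\int_{\mathbb R^N}f\varphi\,dx$ for all $\varphi\in\dot W^{s,p}(\mathbb R^N)$ with $f\varphi\in L^1(\mathbb R^N)$. Then there is a constant $C>0$ depending only on $N,p,s$ with the following property. Let $1\le r\le\frac{p^*}{p^*-1}$ and $f\in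 L^r(\mathbb R^N)$, and let $u\in\dot W^{s,p}(\mathbb R^N)$ be a weak solution of $(-\Delta_p)^su=f$ in $\mathbb R^N$ that is radial and radially non-increasing, i.e. $u(x)=u(|x|)$ for almost every $x$ (by abuse of notation), where $R\mapsto u(R)$ is a non-increasing real function on $(0,\infty)$. Then $$|u(R)|\le\frac{C\,\|f\|_{L^r(\mathbb R^N)}^{\frac1{p-1}}}{R^{\frac{N-psr}{(p-1)r}}}\qquad\text{for all }R>0.$$ -/

import Mathlib

open MeasureTheory Set
open scoped ENNReal

noncomputable section

namespace FracPLap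

/-- The fractional critical exponent `p* = N p / (N - p s)`. -/
def critExp (N : ℕ) (p s : ℝ) : ℝ := N * p / (N - p * s)

/-- The `p`-th power `[u]_{s,p}^p` of the Gagliardo seminorm,
`∫_{ℝ^N × ℝ^N} |u(x) - u(y)|^p / |x - y|^{N + p s} dx dy`, with values in `[0, ∞]`. -/
def energy {N : ℕ} (p s : ℝ) (u : EuclideanSpace ℝ (Fin N) → ℝ) : ℝ≥0∞ :=
  ∫⁻ z : EuclideanSpace ℝ (Fin N) × EuclideanSpace ℝ (Fin N),
    ENNReal.ofReal (|u z.1 - u z.2| ^ p / ‖z.1 - z.2‖ ^ ((N : ℝ) + p * s))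

/-- `u` vanishes at infinity: every set `{|u| > a}`, `a > 0`, has finite Lebesgue measure. -/
def VanishesAtInfinity {N : ℕ} (u : EuclideanSpace ℝ (Fin N) → ℝ) : Prop :=
  ∀ a : ℝ, 0 < a → volume {x | a < |u x|} < ∞

/-- The homogeneous fractional Sobolev space of order `s` and exponent `p` on `ℝ^N`:
(Lebesgue) measurable functions that vanish at infinity and have finite seminorm. -/
def MemHomSobolev {N : ℕ} (p s : ℝ) (u : EuclideanSpace ℝ (Fin N) → ℝ) : Prop :=
  AEMeasurable u volume ∧ VanishesAtInfinity u ∧ energy p s u < ∞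

/-- `u` is a weak solution of `(-Δ_p)^s u = f` in `ℝ^N`. The operator `(-Δ_p)^s` is the
differential of the functional `u ↦ (1/p) [u]_{s,p}^p` on the homogeneous Sobolev space, so its
pairing with `φ` is the derivative of `t ↦ (1/p) [u + t φ]_{s,p}^p` at `t = 0`. This has to be
`∫ f φ` for every `φ` in the space such that `f φ` is integrable. -/
def IsWeakSolution {N : ℕ} (p s : ℝ) (f u : EuclideanSpace ℝ (Fin N) → ℝ) : Prop :=
  MemHomSobolev p s u ∧
    ∀ φ : EuclideanSpace ℝ (Fin N) → ℝ, MemHomSobolev p s φ →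
      Integrable (fun x => f x * φ x) volume →
      HasDerivAt (fun t : ℝ => 1 / p * (energy p s (fun x => u x + t * φ x)).toReal)
        (∫ x, f x * φ x) 0

/-- `u` is radial and radially non-increasing with profile `U`: `u(x) = U(|x|)` for almost every
`x`, where `U` is non-increasing on `(0, ∞)`. Nothing is required at the origin, where `u` may be
unbounded. -/
def IsRadiallyDecreasing {N : ℕ} (u : EuclideanSpace ℝ (Fin N) → ℝ) (U : ℝ → ℝ) : Prop :=
  AntitoneOn U (Ioi 0) ∧ ∀ᵐ x ∂(volume : Measure (EuclideanSpace ℝ (Fin N))), u x = U ‖x‖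

end FracPLap

end

/-! Write `q` for the critical exponent. The equation is tested with a slice `v` of `u` between the
levels `h = U R / 2` and `2 * h`. As `v` is a nondecreasing contraction of `u`, convexity gives
`[v]^p ≤ ∫ f v` (`energy_toReal_le_of_hasDerivAt`). With `A = ∫ v ^ q`, Sobolev bounds the left side
below by a multiple of `A ^ (p / q)` (`exists_sobolev_const`), while Hölder and `v ≤ h` bound the
right side by `‖f‖_r * h ^ (1 - q * τ) * A ^ τ`, `τ = 1 - 1 / r` (`integral_mul_le_of_le`).
Monotonicity gives `v = h` on the ball of radius `R`, so `A` is at least `h ^ q` times its volume.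
As `p / q > τ`, this turns the inequality into an upper bound for `h` (`two_mul_le_of_rpow_bound`).
-/

namespace FracPLap

variable {N : ℕ} {p s : ℝ}

/-! ### Fractional Sobolev inequality -/

/-- The nonlocal gradient density `∫ |u(x) - u(y)|^p / |x - y|^{N + p s} dy` dominates a power of
`u(x)`, since `u` is at most `u(x) / 2` on half of a suitable ball around `x`. -/
theorem rpow_le_lintegral_gagliardo (hN : 0 < N) (hp : 0 < p) (hs : 0 < s) {q A : ℝ}
    (hq : 0 < q) (hpq : p + q * (p * s / N) = q) (hA : 0 < A)
    {v : EuclideanSpace ℝ (Fin N) → ℝ} (hv : AEMeasurable v volume)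
    (hvA : ∫⁻ x, ENNReal.ofReal (v x ^ q) ≤ ENNReal.ofReal A)
    (x : EuclideanSpace ℝ (Fin N)) (hx : 0 < v x) :
    ENNReal.ofReal ((2 : ℝ) ^ (-q) *
        ((volume (Metric.ball (0 : EuclideanSpace ℝ (Fin N)) 1)).toReal / 2) ^ (1 + p * s / N) *
        A ^ (-(p * s / N)) * v x ^ q) ≤
      ∫⁻ y, ENNReal.ofReal (|v x - v y| ^ p / ‖x - y‖ ^ ((N : ℝ) + p * s)) := by
  have : Nonempty (Fin N) := ⟨⟨0, hN⟩⟩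
  have hN' : (0 : ℝ) < N := by exact_mod_cast hN
  set t := v x with ht
  set w := (volume (Metric.ball (0 : EuclideanSpace ℝ (Fin N)) 1)).toReal with hw
  have hw0 : 0 < w := ENNReal.toReal_pos (Metric.measure_ball_pos _ _ one_pos).ne'
    measure_ball_lt_top.ne
  set σ := p * s / N with hσ
  have hσ0 : 0 < σ := by positivity
  -- `V` is the Chebyshev bound for the measure of `{v ≥ t / 2}`, and `ρ` is chosen so that the ball
  -- has measure `2 * V`.
  set V := 2 ^ q * A / t ^ q with hV
  have hV0 : 0 < V := by positivity
  set ρ := (2 * V / w) ^ (1 / (N : ℝ)) with hρ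
  have hρ0 : 0 < ρ := by positivity
  have hball : volume (Metric.ball x ρ) = ENNReal.ofReal (2 * V) := by
    rw [Measure.addHaar_ball volume x hρ0.le, finrank_euclideanSpace_fin,
      ← ENNReal.ofReal_toReal (measure_ball_lt_top
        (μ := (volume : Measure (EuclideanSpace ℝ (Fin N)))) (x := 0) (r := 1)).ne,
      ← ENNReal.ofReal_mul (by positivity), ← hw, hρ, ← Real.rpow_natCast,
      ← Real.rpow_mul (by positivity), one_div_mul_cancel hN'.ne', Real.rpow_one]
    congr 1
    field_simp
  have hlevel : volume {y | t / 2 ≤ v y} ≤ ENNReal.ofReal V := by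
    have hpos : 0 < (t / 2) ^ q := by positivity
    have hsub : {y | t / 2 ≤ v y} ⊆
        {y | ENNReal.ofReal ((t / 2) ^ q) ≤ ENNReal.ofReal (v y ^ q)} := fun y hy =>
      ENNReal.ofReal_le_ofReal (Real.rpow_le_rpow (by positivity) hy hq.le)
    calc volume {y | t / 2 ≤ v y} ≤ _ := measure_mono hsub
      _ ≤ (∫⁻ y, ENNReal.ofReal (v y ^ q)) / ENNReal.ofReal ((t / 2) ^ q) :=
        meas_ge_le_lintegral_div (hv.pow_const q).ennreal_ofReal
          (ENNReal.ofReal_pos.2 hpos).ne' ENNReal.ofReal_ne_top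
      _ ≤ ENNReal.ofReal A / ENNReal.ofReal ((t / 2) ^ q) := by gcongr
      _ = ENNReal.ofReal V := by
        rw [← ENNReal.ofReal_div_of_pos hpos, hV, Real.div_rpow hx.le zero_le_two]
        congr 1
        field_simp
  set ε := (t / 2) ^ p / ρ ^ ((N : ℝ) + p * s) with hε
  have hgood : Metric.ball x ρ \ {y | t / 2 ≤ v y} ⊆ {y | ENNReal.ofReal ε ≤
      ENNReal.ofReal (|t - v y| ^ p / ‖x - y‖ ^ ((N : ℝ) + p * s))} := by
    rintro y ⟨hy, hyv⟩
    simp only [mem_ofPred_eq, not_le] at hyv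
    have hxy : 0 < ‖x - y‖ := norm_pos_iff.2 (sub_ne_zero.2 (by rintro rfl; linarith))
    have hyρ : ‖x - y‖ ≤ ρ := by
      rw [← dist_eq_norm, dist_comm]; exact (Metric.mem_ball.1 hy).le
    have hd : t / 2 ≤ |t - v y| := by rw [le_abs]; left; linarith
    refine ENNReal.ofReal_le_ofReal ?_
    rw [hε]
    gcongr
  have hmeas : AEMeasurable
      (fun y => ENNReal.ofReal (|t - v y| ^ p / ‖x - y‖ ^ ((N : ℝ) + p * s))) volume := by
    refine AEMeasurable.ennreal_ofReal (AEMeasurable.div ?_ ?_)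
    · exact ((hv.const_sub t).abs).pow_const p
    · exact (Measurable.pow_const (by fun_prop) _).aemeasurable
  have hvol : ENNReal.ofReal V ≤ volume (Metric.ball x ρ \ {y | t / 2 ≤ v y}) := by
    refine le_trans ?_ le_measure_sdiff
    rw [hball]
    refine le_trans ?_ (tsub_le_tsub_left hlevel _)
    rw [← ENNReal.ofReal_sub _ hV0.le]
    exact ENNReal.ofReal_le_ofReal (by linarith)
  -- `ε * V` scales like `t ^ p * V ^ (-σ)`, hence like `t ^ (p + q * σ) * A ^ (-σ)`; criticality
  -- makes the exponent of `t` equal to `q`.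
  have key : (2 : ℝ) ^ (-q) * (w / 2) ^ (1 + σ) * A ^ (-σ) * t ^ q = ε * V := by
    have hρpow : ρ ^ ((N : ℝ) + p * s) = (2 * V / w) ^ (1 + σ) := by
      rw [hρ, ← Real.rpow_mul (by positivity)]
      congr 1
      rw [hσ]
      field_simp
    rw [hε, hρpow]
    have h1 : (2 * V / w) ^ (1 + σ) = V * V ^ σ / (w / 2) ^ (1 + σ) := by
      rw [show 2 * V / w = V / (w / 2) by field_simp, Real.div_rpow hV0.le (by positivity),
        Real.rpow_add hV0, Real.rpow_one]
    have h2 : V ^ σ = 2 ^ (q * σ) * A ^ σ / t ^ (q * σ) := by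
      rw [hV, Real.div_rpow (by positivity) (by positivity),
        Real.mul_rpow (by positivity) hA.le, ← Real.rpow_mul zero_le_two, ← Real.rpow_mul hx.le]
    have h3 : t ^ q = t ^ p * t ^ (q * σ) := by rw [← Real.rpow_add hx, hpq]
    have h4 : (2 : ℝ) ^ q = 2 ^ p * 2 ^ (q * σ) := by rw [← Real.rpow_add two_pos, hpq]
    rw [h1, h2, Real.rpow_neg zero_le_two, Real.rpow_neg hA.le, h3, h4,
      Real.div_rpow hx.le zero_le_two]
    field_simp
  rw [key, ENNReal.ofReal_mul (by positivity)]
  calc ENNReal.ofReal ε * ENNReal.ofReal V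
      ≤ ENNReal.ofReal ε * volume {y | ENNReal.ofReal ε ≤
        ENNReal.ofReal (|t - v y| ^ p / ‖x - y‖ ^ ((N : ℝ) + p * s))} :=
        mul_le_mul_right (hvol.trans (measure_mono hgood)) _
    _ ≤ _ := mul_meas_ge_le_lintegral₀ hmeas _

theorem energy_eq_lintegral_lintegral {v : EuclideanSpace ℝ (Fin N) → ℝ}
    (hv : AEMeasurable v volume) :
    energy p s v = ∫⁻ x, ∫⁻ y,
      ENNReal.ofReal (|v x - v y| ^ p / ‖x - y‖ ^ ((N : ℝ) + p * s)) := by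
  rw [energy, Measure.volume_eq_prod, lintegral_prod]
  refine AEMeasurable.ennreal_ofReal (AEMeasurable.div ?_ ?_)
  · exact ((hv.comp_fst.sub hv.comp_snd).abs).pow_const p
  · exact (Measurable.pow_const (by fun_prop) _).aemeasurable

/-- The fractional Sobolev inequality for nonnegative functions with finite critical norm. -/
theorem exists_sobolev_const (hN : 0 < N) (hp : 0 < p) (hs : 0 < s) {q : ℝ}
    (hq : 0 < q) (hpq : p + q * (p * s / N) = q) :
    ∃ c : ℝ, 0 < c ∧ ∀ (A : ℝ) (v : EuclideanSpace ℝ (Fin N) → ℝ), 0 < A →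
      AEMeasurable v volume → (∀ x, 0 ≤ v x) →
      ∫⁻ x, ENNReal.ofReal (v x ^ q) = ENNReal.ofReal A →
      ENNReal.ofReal (c * A ^ (1 - p * s / N)) ≤ energy p s v := by
  have : Nonempty (Fin N) := ⟨⟨0, hN⟩⟩
  set w := (volume (Metric.ball (0 : EuclideanSpace ℝ (Fin N)) 1)).toReal with hw
  have hw0 : 0 < w := ENNReal.toReal_pos (Metric.measure_ball_pos _ _ one_pos).ne'
    measure_ball_lt_top.ne
  refine ⟨(2 : ℝ) ^ (-q) * (w / 2) ^ (1 + p * s / N), by positivity, ?_⟩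
  intro A v hA hv hv0 hvA
  set c := (2 : ℝ) ^ (-q) * (w / 2) ^ (1 + p * s / N) with hc
  have hc0 : 0 < c := by positivity
  rw [energy_eq_lintegral_lintegral hv]
  calc ENNReal.ofReal (c * A ^ (1 - p * s / N))
      = ENNReal.ofReal (c * A ^ (-(p * s / N))) * ENNReal.ofReal A := by
        rw [← ENNReal.ofReal_mul (by positivity), sub_eq_add_neg, Real.rpow_add hA,
          Real.rpow_one]
        ring_nf
    _ = ∫⁻ x, ENNReal.ofReal (c * A ^ (-(p * s / N)) * v x ^ q) := by
        rw [← hvA, ← lintegral_const_mul' _ _ ENNReal.ofReal_ne_top]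
        simp_rw [← ENNReal.ofReal_mul (show 0 ≤ c * A ^ (-(p * s / N)) by positivity)]
    _ ≤ _ := by
        refine lintegral_mono fun x => ?_
        rcases (hv0 x).eq_or_lt with h | h
        · rw [← h, Real.zero_rpow hq.ne']; simp
        · exact rpow_le_lintegral_gagliardo hN hp hs hq hpq hA hv hvA.le x h

/-! ### Testing the equation with contractions -/

/-- Equal signs give `|a + t * b| = |a| + t * |b|`. Bernoulli's inequality then yields the linear
term `p * t * |a| ^ (p - 1) * |b|`, which dominates `p * t * |b| ^ p`. -/
theorem abs_rpow_add_le_of_mul_nonneg (hp : 1 ≤ p) {a b t : ℝ} (hab : 0 ≤ a * b)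
    (hba : |b| ≤ |a|) (ht : 0 ≤ t) :
    |a| ^ p + p * t * |b| ^ p ≤ |a + t * b| ^ p := by
  have h : |a + t * b| = |a| + t * |b| := by
    rw [abs_add_eq_add_abs_iff _ _ |>.2, abs_mul, abs_of_nonneg ht]
    rcases le_total 0 a with ha | ha <;> rcases le_total 0 b with hb | hb
    · exact Or.inl ⟨ha, by positivity⟩
    · rcases hb.eq_or_lt with rfl | hb
      · exact Or.inl ⟨ha, by simp⟩
      · have : a = 0 := by nlinarith
        subst this; exact Or.inr ⟨le_rfl, mul_nonpos_of_nonneg_of_nonpos ht hb.le⟩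
    · rcases hb.eq_or_lt with rfl | hb
      · exact Or.inr ⟨ha, by simp⟩
      · have : a = 0 := by nlinarith
        subst this; exact Or.inl ⟨le_rfl, by positivity⟩
    · exact Or.inr ⟨ha, mul_nonpos_of_nonneg_of_nonpos ht hb⟩
  rw [h]
  rcases (abs_nonneg a).eq_or_lt with ha | ha
  · have hb : |b| = 0 := le_antisymm (hba.trans ha.ge) (abs_nonneg b)
    rw [hb, ← ha, Real.zero_rpow (by linarith)]
    simp [Real.zero_rpow (show p ≠ 0 by linarith)]
  set α := |a|
  set β := |b|
  have hβ : 0 ≤ β := abs_nonneg b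
  have h1 : 1 + p * (t * β / α) ≤ (1 + t * β / α) ^ p :=
    one_add_mul_self_le_rpow_one_add (by have : 0 ≤ t * β / α := by positivity
                                         linarith) hp
  have h2 : (α + t * β) ^ p = α ^ p * (1 + t * β / α) ^ p := by
    rw [← Real.mul_rpow ha.le (by positivity)]
    congr 1
    field_simp
  have h3 : β ^ p ≤ α ^ p * (β / α) := by
    rcases hβ.eq_or_lt with h0 | h0
    · rw [← h0, Real.zero_rpow (by linarith)]; simp
    · have e : ∀ z : ℝ, 0 < z → z ^ p = z ^ (p - 1) * z := fun z hz => by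
        rw [← Real.rpow_add_one hz.ne']; congr 1; ring
      rw [e β h0, e α ha]
      have : β ^ (p - 1) ≤ α ^ (p - 1) := Real.rpow_le_rpow hβ hba (by linarith)
      calc β ^ (p - 1) * β ≤ α ^ (p - 1) * β := by gcongr
        _ = _ := by field_simp
  calc α ^ p + p * t * β ^ p ≤ α ^ p + p * t * (α ^ p * (β / α)) := by gcongr
    _ = α ^ p * (1 + p * (t * β / α)) := by ring
    _ ≤ _ := by rw [h2]; gcongr

theorem energy_mono_of_abs_le {c : ℝ} (hc : 0 ≤ c) (hp : 0 ≤ p)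
    {u v : EuclideanSpace ℝ (Fin N) → ℝ} (h : ∀ x y, |v x - v y| ≤ c * |u x - u y|) :
    energy p s v ≤ ENNReal.ofReal (c ^ p) * energy p s u := by
  rw [energy, energy, ← lintegral_const_mul' _ _ ENNReal.ofReal_ne_top]
  refine lintegral_mono fun z => ?_
  rw [← ENNReal.ofReal_mul (by positivity)]
  refine ENNReal.ofReal_le_ofReal ?_
  rw [← mul_div_assoc, ← Real.mul_rpow hc (abs_nonneg _)]
  gcongr
  exact h _ _

/-- Testing with a nondecreasing contraction `v` of `u`: the pairing with `(-Δ_p)^s u` dominates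
the energy of `v`. -/
theorem energy_toReal_le_of_hasDerivAt (hp : 1 < p) {u v : EuclideanSpace ℝ (Fin N) → ℝ}
    {d : ℝ} (hv : AEMeasurable v volume) (hE : energy p s u < ∞)
    (hsign : ∀ x y, 0 ≤ (u x - u y) * (v x - v y)) (habs : ∀ x y, |v x - v y| ≤ |u x - u y|)
    (hd : HasDerivAt (fun t : ℝ => 1 / p * (energy p s (fun x => u x + t * v x)).toReal) d 0) :
    (energy p s v).toReal ≤ d := by
  have hp0 : 0 < p := by linarith
  have hEv : energy p s v < ∞ := by
    refine (energy_mono_of_abs_le zero_le_one hp0.le (u := u) (by simpa using habs)).trans_lt ?_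
    exact ENNReal.mul_lt_top ENNReal.ofReal_lt_top hE
  have hfin : ∀ t : ℝ, 0 ≤ t → energy p s (fun x => u x + t * v x) < ∞ := fun t ht => by
    refine (energy_mono_of_abs_le (c := 1 + t) (by linarith) hp0.le (u := u)
      fun x y => ?_).trans_lt (ENNReal.mul_lt_top ENNReal.ofReal_lt_top hE)
    calc |u x + t * v x - (u y + t * v y)| = |(u x - u y) + t * (v x - v y)| := by ring_nf
      _ ≤ |u x - u y| + |t * (v x - v y)| := abs_add_le _ _
      _ ≤ |u x - u y| + t * |u x - u y| := by
        rw [abs_mul, abs_of_nonneg ht]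
        exact add_le_add_right (mul_le_mul_of_nonneg_left (habs x y) ht) _
      _ = _ := by ring
  have hmono : ∀ t : ℝ, 0 ≤ t → (energy p s u).toReal + p * t * (energy p s v).toReal ≤
      (energy p s (fun x => u x + t * v x)).toReal := fun t ht => by
    have h1 : energy p s u + ENNReal.ofReal (p * t) * energy p s v ≤
        energy p s (fun x => u x + t * v x) := by
      have hm : AEMeasurable (fun z : EuclideanSpace ℝ (Fin N) × EuclideanSpace ℝ (Fin N) =>
          ENNReal.ofReal (p * t) *
            ENNReal.ofReal (|v z.1 - v z.2| ^ p / ‖z.1 - z.2‖ ^ ((N : ℝ) + p * s))) volume := by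
        refine AEMeasurable.const_mul (AEMeasurable.ennreal_ofReal (AEMeasurable.div ?_ ?_)) _
        · rw [Measure.volume_eq_prod]
          exact ((hv.comp_fst.sub hv.comp_snd).abs).pow_const p
        · exact (Measurable.pow_const (by fun_prop) _).aemeasurable
      rw [energy, energy, energy, ← lintegral_const_mul' _ _ ENNReal.ofReal_ne_top,
        ← lintegral_add_right' _ hm]
      refine lintegral_mono fun z => ?_
      rw [← ENNReal.ofReal_mul (by positivity), ← ENNReal.ofReal_add (by positivity)
        (by positivity), ← mul_div_assoc, ← add_div]
      refine ENNReal.ofReal_le_ofReal ?_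
      gcongr
      refine (abs_rpow_add_le_of_mul_nonneg hp.le (hsign _ _) (habs _ _) ht).trans_eq ?_
      ring_nf
    have h2 := ENNReal.toReal_mono (hfin t ht).ne h1
    rwa [ENNReal.toReal_add hE.ne (ENNReal.mul_lt_top ENNReal.ofReal_lt_top hEv).ne,
      ENNReal.toReal_mul, ENNReal.toReal_ofReal (by positivity)] at h2
  -- The right difference quotients already exceed the energy of `v`, so the one-sided limit
  -- suffices.
  have hlim := hd.tendsto_slope_zero_right
  refine ge_of_tendsto hlim ?_
  filter_upwards [self_mem_nhdsWithin] with t ht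
  have ht : 0 < t := ht
  have h := hmono t ht.le
  simp only [zero_add, zero_mul, add_zero, smul_eq_mul]
  rw [← mul_sub, inv_mul_eq_div, le_div_iff₀ ht, one_div, inv_mul_eq_div, le_div_iff₀ hp0]
  linarith

/-! ### Estimate of the right-hand side -/

/-- Hölder's inequality interpolated with the bound `v ≤ h`. -/
theorem integral_mul_le_of_le {α : Type*} [MeasurableSpace α] {μ : Measure α} {r q h A : ℝ}
    (hr : 1 ≤ r) (hrq : q * (1 - 1 / r) ≤ 1) (hh : 0 < h) (hA : 0 ≤ A)
    {f v : α → ℝ} (hf : MemLp f (ENNReal.ofReal r) μ) (hv : AEMeasurable v μ)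
    (hv0 : ∀ x, 0 ≤ v x) (hvh : ∀ x, v x ≤ h)
    (hvA : ∫⁻ x, ENNReal.ofReal (v x ^ q) ∂μ = ENNReal.ofReal A) :
    Integrable (fun x => f x * v x) μ ∧
      ∫ x, f x * v x ∂μ ≤ (eLpNorm f (ENNReal.ofReal r) μ).toReal *
        h ^ (1 - q * (1 - 1 / r)) * A ^ (1 - 1 / r) := by
  have hr0 : 0 < r := by linarith
  set τ := 1 - 1 / r with hτ
  have hτ0 : 0 ≤ τ := by
    rw [hτ, sub_nonneg, div_le_one hr0]; exact hr
  have hnorm : eLpNorm f (ENNReal.ofReal r) μ = (∫⁻ x, ‖f x‖ₑ ^ r ∂μ) ^ (1 / r) := by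
    rw [eLpNorm_eq_lintegral_rpow_enorm_toReal (ENNReal.ofReal_pos.2 hr0).ne'
      ENNReal.ofReal_ne_top, ENNReal.toReal_ofReal hr0.le]
  have hle : ∫⁻ x, ‖f x * v x‖ₑ ∂μ ≤ ENNReal.ofReal ((eLpNorm f (ENNReal.ofReal r) μ).toReal *
        h ^ (1 - q * τ) * A ^ τ) := by
    -- Hölder with weights `1 / r` and `τ`, summing to 1, includes `r = 1` without an infinite
    -- conjugate exponent.
    have hpt : ∀ x, ‖f x * v x‖ₑ ≤ ENNReal.ofReal (h ^ (1 - q * τ)) *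
        ((‖f x‖ₑ ^ r) ^ (1 / r) * ENNReal.ofReal (v x ^ q) ^ τ) := fun x => by
      rw [enorm_mul, ← ENNReal.rpow_mul, mul_one_div_cancel hr0.ne', ENNReal.rpow_one,
        ENNReal.ofReal_rpow_of_nonneg (Real.rpow_nonneg (hv0 x) _) hτ0, ← Real.rpow_mul (hv0 x),
        mul_left_comm, ← ENNReal.ofReal_mul (by positivity), Real.enorm_of_nonneg (hv0 x)]
      gcongr
      rcases (hv0 x).eq_or_lt with h0 | h0
      · rw [← h0]; positivity
      calc v x = v x ^ (1 - q * τ) * v x ^ (q * τ) := by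
            rw [← Real.rpow_add h0]; simp
        _ ≤ _ := by
          gcongr
          exact hvh x
    calc ∫⁻ x, ‖f x * v x‖ₑ ∂μ ≤ ∫⁻ x, ENNReal.ofReal (h ^ (1 - q * τ)) *
          ((‖f x‖ₑ ^ r) ^ (1 / r) * ENNReal.ofReal (v x ^ q) ^ τ) ∂μ := lintegral_mono hpt
      _ = ENNReal.ofReal (h ^ (1 - q * τ)) * ∫⁻ x,
          ((‖f x‖ₑ ^ r) ^ (1 / r) * ENNReal.ofReal (v x ^ q) ^ τ) ∂μ :=
        lintegral_const_mul' _ _ ENNReal.ofReal_ne_top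
      _ ≤ ENNReal.ofReal (h ^ (1 - q * τ)) * ((∫⁻ x, ‖f x‖ₑ ^ r ∂μ) ^ (1 / r) *
          (∫⁻ x, ENNReal.ofReal (v x ^ q) ∂μ) ^ τ) := by
        gcongr
        exact ENNReal.lintegral_mul_norm_pow_le
          (hf.aestronglyMeasurable.aemeasurable.enorm.pow_const r)
          (hv.pow_const q).ennreal_ofReal (by positivity) hτ0 (by rw [hτ]; ring)
      _ = _ := by
        rw [← hnorm, hvA, ENNReal.ofReal_rpow_of_nonneg hA hτ0, mul_assoc,
          mul_left_comm (ENNReal.toReal _),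
          ENNReal.ofReal_mul (by positivity), ENNReal.ofReal_mul ENNReal.toReal_nonneg,
          ENNReal.ofReal_toReal hf.eLpNorm_ne_top]
  have hint : Integrable (fun x => f x * v x) μ :=
    ⟨hf.aestronglyMeasurable.mul hv.aestronglyMeasurable, hle.trans_lt ENNReal.ofReal_lt_top⟩
  refine ⟨hint, ?_⟩
  calc ∫ x, f x * v x ∂μ ≤ ‖∫ x, f x * v x ∂μ‖ := Real.le_norm_self _
    _ ≤ _ := by
      have := (enorm_integral_le_lintegral_enorm (fun x => f x * v x)).trans hle
      rwa [← ofReal_norm, ENNReal.ofReal_le_ofReal_iff (by positivity)] at this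

/-! ### Sign of the profile -/

/-- A radially non-increasing function that vanishes at infinity has a nonnegative profile. -/
theorem IsRadiallyDecreasing.nonneg (hN : 0 < N) {u : EuclideanSpace ℝ (Fin N) → ℝ} {U : ℝ → ℝ}
    (h : IsRadiallyDecreasing u U) (hu : VanishesAtInfinity u) {R : ℝ} (hR : 0 < R) :
    0 ≤ U R := by
  by_contra! hneg
  have : Nonempty (Fin N) := ⟨⟨0, hN⟩⟩
  have hsub : ((Metric.closedBall (0 : EuclideanSpace ℝ (Fin N)) R)ᶜ : Set _) ≤ᵐ[volume]
      {x | -U R / 2 < |u x|} := by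
    filter_upwards [h.2] with x hx hxR
    have hxR : R < ‖x‖ := by
      have : x ∉ Metric.closedBall (0 : EuclideanSpace ℝ (Fin N)) R := hxR
      simpa using this
    have := h.1 hR (hR.trans hxR) hxR.le
    change -U R / 2 < |u x|
    rw [hx, lt_abs]
    right
    linarith
  have hlt := (measure_mono_ae hsub).trans_lt (hu (-U R / 2) (by linarith))
  have htot : volume (univ : Set (EuclideanSpace ℝ (Fin N))) < ∞ := by
    rw [← union_compl_self (Metric.closedBall (0 : EuclideanSpace ℝ (Fin N)) R)]
    exact (measure_union_le _ _).trans_lt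
      (ENNReal.add_lt_top.2 ⟨measure_closedBall_lt_top, hlt⟩)
  rw [measure_univ_of_isAddLeftInvariant] at htot
  exact lt_irrefl _ htot

/-! ### Solving the inequality for the level -/

/-- The constant in the radial decay estimate, from the Sobolev constant `c` and the measure `w` of
the unit ball. -/
theorem two_mul_le_of_rpow_bound {n p s c w q τ A F h R r : ℝ} (hp : 1 < p) (hn : 0 < n)
    (hs : 0 < s) (hpq : p + q * (p * s / n) = q) (hq : 0 < q) (hτ : τ = 1 - 1 / r) (hr : 1 ≤ r)
    (hqτ : q * τ ≤ 1) (hc : 0 < c) (hw : 0 < w) (hF : 0 ≤ F) (hh : 0 < h) (hR : 0 < R)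
    (hA : h ^ q * (R ^ n * w) ≤ A)
    (hb : c * A ^ (1 - p * s / n) ≤ F * h ^ (1 - q * τ) * A ^ τ) :
    2 * h ≤ 2 * (1 / (c * min w 1)) ^ (1 / (p - 1)) * F ^ (1 / (p - 1)) /
      R ^ ((n - p * s * r) / ((p - 1) * r)) := by
  have hp1 : 0 < p - 1 := by linarith
  have hr0 : 0 < r := by linarith
  have hτ0 : 0 ≤ τ := by rw [hτ, sub_nonneg, div_le_one hr0]; exact hr
  have hB : 0 < h ^ q * (R ^ n * w) := by positivity
  have hA0 : 0 < A := hB.trans_le hA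
  -- `m` is the power of `A` left after cancelling `A ^ τ`; it is positive because `q * τ ≤ 1 < p`.
  set m := 1 - p * s / n - τ with hm
  have hqm : q * m = p - q * τ := by rw [hm]; linear_combination -hpq
  have hm0 : 0 ≤ m := by
    have : 0 < q * m := by rw [hqm]; linarith
    exact (pos_of_mul_pos_right this hq.le).le
  have hm1 : m ≤ 1 := by
    have : 0 < p * s / n := by positivity
    linarith
  -- Since `0 ≤ m ≤ 1`, this removes the dependence of the constant on `r`.
  have hW : min w 1 ≤ w ^ m := by
    rcases le_total 1 w with h1 | h1
    · exact (min_le_right _ _).trans (Real.one_le_rpow h1 hm0)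
    · refine (min_le_left _ _).trans ?_
      simpa using Real.rpow_le_rpow_of_exponent_ge hw h1 hm1
  have hW0 : 0 < min w 1 := lt_min hw one_pos
  have h1 : c * A ^ m ≤ F * h ^ (1 - q * τ) := by
    have e : A ^ (1 - p * s / n) = A ^ m * A ^ τ := by
      rw [← Real.rpow_add hA0]; congr 1; rw [hm]; ring
    rw [e, ← mul_assoc] at hb
    exact le_of_mul_le_mul_right hb (by positivity)
  have h2 : (h ^ (p - 1) * h ^ (1 - q * τ)) * (R ^ (n * m) * w ^ m) ≤ A ^ m := by
    refine (Real.rpow_le_rpow hB.le hA hm0).trans_eq' ?_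
    rw [Real.mul_rpow (by positivity) (by positivity), Real.mul_rpow (by positivity) hw.le,
      ← Real.rpow_mul hh.le, ← Real.rpow_mul hR.le, hqm, ← Real.rpow_add hh]
    ring_nf
  have h3 : h ^ (p - 1) ≤ 1 / (c * min w 1) * F / R ^ (n * m) := by
    have hpos : 0 < h ^ (1 - q * τ) := by positivity
    have : h ^ (p - 1) * (c * min w 1 * R ^ (n * m)) * h ^ (1 - q * τ) ≤
        F * h ^ (1 - q * τ) := by
      calc h ^ (p - 1) * (c * min w 1 * R ^ (n * m)) * h ^ (1 - q * τ)
          ≤ h ^ (p - 1) * (c * w ^ m * R ^ (n * m)) * h ^ (1 - q * τ) := by gcongr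
        _ = c * ((h ^ (p - 1) * h ^ (1 - q * τ)) * (R ^ (n * m) * w ^ m)) := by ring
        _ ≤ c * A ^ m := by gcongr
        _ ≤ _ := h1
    have := le_of_mul_le_mul_right this hpos
    calc h ^ (p - 1) ≤ F / (c * min w 1 * R ^ (n * m)) := by
          rwa [le_div_iff₀ (by positivity)]
      _ = _ := by field_simp
  have h4 : h ≤ (1 / (c * min w 1) * F / R ^ (n * m)) ^ (1 / (p - 1)) := by
    have := Real.rpow_le_rpow (by positivity) h3 (show 0 ≤ 1 / (p - 1) by positivity)
    rwa [← Real.rpow_mul hh.le, mul_one_div_cancel hp1.ne', Real.rpow_one] at this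
  have h5 : n * m * (1 / (p - 1)) = (n - p * s * r) / ((p - 1) * r) := by
    rw [hm, hτ]
    field_simp
    ring
  rw [Real.div_rpow (by positivity) (by positivity), Real.mul_rpow (by positivity) hF,
    ← Real.rpow_mul hR.le, h5] at h4
  calc 2 * h ≤ _ := mul_le_mul_of_nonneg_left h4 zero_le_two
    _ = _ := by ring

/-! ### Level slices -/

/-- The part of `u` between the levels `h` and `2 h`. -/
def levelSlice (h u : ℝ) : ℝ := min (max (u - h) 0) h

theorem levelSlice_nonneg {h : ℝ} (hh : 0 ≤ h) (u : ℝ) : 0 ≤ levelSlice h u :=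
  le_min (le_max_right _ _) hh

theorem levelSlice_le (h u : ℝ) : levelSlice h u ≤ h := min_le_right _ _

theorem levelSlice_of_le {h u : ℝ} (hu : u ≤ h) (hh : 0 ≤ h) : levelSlice h u = 0 := by
  rw [levelSlice, max_eq_right (by linarith), min_eq_left hh]

theorem levelSlice_of_ge {h u : ℝ} (hu : 2 * h ≤ u) : levelSlice h u = h :=
  min_eq_right (le_max_of_le_left (by linarith))

theorem monotone_levelSlice (h : ℝ) : Monotone (levelSlice h) := fun a b hab => by
  unfold levelSlice; gcongr

theorem abs_levelSlice_sub_le (h a b : ℝ) : |levelSlice h a - levelSlice h b| ≤ |a - b| := by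
  unfold levelSlice
  refine (abs_min_sub_min_le_max _ _ _ _).trans (max_le ?_ (by simp))
  refine (abs_max_sub_max_le_max _ _ _ _).trans (max_le ?_ (by simp))
  simp

theorem levelSlice_sub_mul_nonneg (h a b : ℝ) :
    0 ≤ (a - b) * (levelSlice h a - levelSlice h b) := by
  rcases le_total a b with hab | hab
  · exact mul_nonneg_of_nonpos_of_nonpos (by linarith)
      (sub_nonpos.2 (monotone_levelSlice h hab))
  · exact mul_nonneg (by linarith) (sub_nonneg.2 (monotone_levelSlice h hab))

theorem lintegral_levelSlice_rpow_lt_top {u : EuclideanSpace ℝ (Fin N) → ℝ}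
    (hu : VanishesAtInfinity u) {h q : ℝ} (hh : 0 < h) (hq : 0 < q) :
    ∫⁻ x, ENNReal.ofReal (levelSlice h (u x) ^ q) < ∞ := by
  calc ∫⁻ x, ENNReal.ofReal (levelSlice h (u x) ^ q)
      ≤ ∫⁻ x, {x | h < |u x|}.indicator (fun _ => ENNReal.ofReal (h ^ q)) x := by
        refine lintegral_mono fun x => ?_
        by_cases hx : h < |u x|
        · rw [indicator_of_mem (by exact hx)]
          exact ENNReal.ofReal_le_ofReal
            (Real.rpow_le_rpow (levelSlice_nonneg hh.le _) (levelSlice_le _ _) hq.le)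
        · rw [levelSlice_of_le ((le_abs_self _).trans (not_lt.1 hx)) hh.le,
            Real.zero_rpow hq.ne']
          simp
    _ ≤ ENNReal.ofReal (h ^ q) * volume {x | h < |u x|} := lintegral_indicator_const_le _ _
    _ < ∞ := ENNReal.mul_lt_top ENNReal.ofReal_lt_top (hu h hh)

theorem IsRadiallyDecreasing.le_lintegral_levelSlice (hN : 0 < N)
    {u : EuclideanSpace ℝ (Fin N) → ℝ} {U : ℝ → ℝ} (h : IsRadiallyDecreasing u U)
    (hu : AEMeasurable u volume) {l R q : ℝ} (hR : 0 < R) (hl : 0 < l) (hlR : 2 * l ≤ U R) :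
    ENNReal.ofReal (l ^ q * (R ^ (N : ℝ) *
        (volume (Metric.ball (0 : EuclideanSpace ℝ (Fin N)) 1)).toReal)) ≤
      ∫⁻ x, ENNReal.ofReal (levelSlice l (u x) ^ q) := by
  have : Nonempty (Fin N) := ⟨⟨0, hN⟩⟩
  have hball : volume (Metric.ball (0 : EuclideanSpace ℝ (Fin N)) R) = ENNReal.ofReal
      (R ^ (N : ℝ) * (volume (Metric.ball (0 : EuclideanSpace ℝ (Fin N)) 1)).toReal) := by
    rw [Measure.addHaar_ball volume _ hR.le, finrank_euclideanSpace_fin,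
      ENNReal.ofReal_mul (by positivity), ENNReal.ofReal_toReal measure_ball_lt_top.ne,
      Real.rpow_natCast]
  have hsub : (Metric.ball (0 : EuclideanSpace ℝ (Fin N)) R : Set _) ≤ᵐ[volume]
      {x | ENNReal.ofReal (l ^ q) ≤ ENNReal.ofReal (levelSlice l (u x) ^ q)} := by
    -- The profile is controlled only on `(0, ∞)`, so the origin is discarded.
    have h0 : ∀ᵐ x ∂(volume : Measure (EuclideanSpace ℝ (Fin N))), x ≠ 0 :=
      compl_mem_ae_iff.2 (measure_singleton 0)
    filter_upwards [h.2, h0] with x hx hx0 hxR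
    have hxR : ‖x‖ < R := mem_ball_zero_iff.1 hxR
    have := h.1 (norm_pos_iff.2 hx0) hR hxR.le
    change ENNReal.ofReal (l ^ q) ≤ ENNReal.ofReal (levelSlice l (u x) ^ q)
    rw [levelSlice_of_ge (by rw [hx]; linarith)]
  rw [ENNReal.ofReal_mul (by positivity), ← hball]
  refine (mul_le_mul_right (measure_mono_ae hsub) _).trans (mul_meas_ge_le_lintegral₀ ?_ _)
  exact (((monotone_levelSlice l).measurable.comp_aemeasurable hu).pow_const q).ennreal_ofReal

end FracPLap

/-! ### The radial decay estimate -/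

theorem corollary4p2 (N : ℕ) (p s : ℝ) (hp : 1 < p) (hs0 : 0 < s) (hs1 : s < 1)
    (hN : p * s < N) :
    ∃ C : ℝ, 0 < C ∧
      ∀ (r : ℝ), 1 ≤ r → r ≤ FracPLap.critExp N p s / (FracPLap.critExp N p s - 1) →
      ∀ (f u : EuclideanSpace ℝ (Fin N) → ℝ) (U : ℝ → ℝ),
        MemLp f (ENNReal.ofReal r) volume →
        FracPLap.IsWeakSolution p s f u →
        FracPLap.IsRadiallyDecreasing u U →
        ∀ R : ℝ, 0 < R →
          |U R| ≤ C * (eLpNorm f (ENNReal.ofReal r) volume).toReal ^ (1 / (p - 1)) /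
            R ^ (((N : ℝ) - p * s * r) / ((p - 1) * r)) := by
  have hp0 : 0 < p := by linarith
  have hn : (0 : ℝ) < N := lt_trans (by positivity) hN
  have hN0 : 0 < N := by exact_mod_cast hn
  have hd : 0 < N - p * s := by linarith
  set q := FracPLap.critExp N p s with hq
  have hq1 : 1 < q := by
    rw [hq, FracPLap.critExp, one_lt_div hd]
    have : 0 < p * s := by positivity
    nlinarith
  have hq0 : 0 < q := by linarith
  have hpq : p + q * (p * s / N) = q := by
    rw [hq, FracPLap.critExp]
    field_simp
    ring
  have : Nonempty (Fin N) := ⟨⟨0, hN0⟩⟩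
  set w := (volume (Metric.ball (0 : EuclideanSpace ℝ (Fin N)) 1)).toReal with hw
  have hw0 : 0 < w := ENNReal.toReal_pos (Metric.measure_ball_pos _ _ one_pos).ne'
    measure_ball_lt_top.ne
  obtain ⟨c, hc, hsob⟩ := FracPLap.exists_sobolev_const (s := s) hN0 hp0 hs0 hq0 hpq
  have hcw : 0 < c * min w 1 := mul_pos hc (lt_min hw0 one_pos)
  refine ⟨2 * (1 / (c * min w 1)) ^ (1 / (p - 1)), by positivity, ?_⟩
  intro r hr hrq f u U hf hsol hrad R hR
  obtain ⟨⟨hum, hu0, huE⟩, htest⟩ := hsol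
  have hr0 : 0 < r := by linarith
  -- The upper bound on `r` enters only here: it keeps the power of `h` in Hölder nonnegative.
  have hqτ : q * (1 - 1 / r) ≤ 1 := by
    rw [le_div_iff₀ (by linarith)] at hrq
    rw [show q * (1 - 1 / r) = q * (r - 1) / r by field_simp, div_le_one hr0]
    linarith
  have hUR := hrad.nonneg hN0 hu0 hR
  rw [abs_of_nonneg hUR]
  rcases hUR.eq_or_lt with hU | hU
  · rw [← hU]; positivity
  set h := U R / 2 with hh
  have hh0 : 0 < h := by positivity
  set v : EuclideanSpace ℝ (Fin N) → ℝ := fun x => FracPLap.levelSlice h (u x) with hv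
  have hvm : AEMeasurable v volume :=
    (FracPLap.monotone_levelSlice h).measurable.comp_aemeasurable hum
  have hv0 : ∀ x, 0 ≤ v x := fun x => FracPLap.levelSlice_nonneg hh0.le _
  have habs : ∀ x y, |v x - v y| ≤ |u x - u y| := fun x y =>
    FracPLap.abs_levelSlice_sub_le _ _ _
  have hsign : ∀ x y, 0 ≤ (u x - u y) * (v x - v y) := fun x y =>
    FracPLap.levelSlice_sub_mul_nonneg _ _ _
  obtain ⟨A, hA⟩ : ∃ A, A = (∫⁻ x, ENNReal.ofReal (v x ^ q)).toReal := ⟨_, rfl⟩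
  have hvA : ∫⁻ x, ENNReal.ofReal (v x ^ q) = ENNReal.ofReal A := by
    rw [hA, ENNReal.ofReal_toReal
      (FracPLap.lintegral_levelSlice_rpow_lt_top hu0 hh0 hq0).ne]
  have hAnn : 0 ≤ A := hA ▸ ENNReal.toReal_nonneg
  have hAlow : h ^ q * (R ^ (N : ℝ) * w) ≤ A := by
    have := hrad.le_lintegral_levelSlice (q := q) hN0 hum hR hh0 (by rw [hh]; linarith)
    rwa [hvA, ENNReal.ofReal_le_ofReal_iff hAnn] at this
  have hA0 : 0 < A := lt_of_lt_of_le (by positivity) hAlow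
  obtain ⟨hint, hle⟩ := FracPLap.integral_mul_le_of_le hr hqτ hh0 hAnn hf hvm hv0
    (fun x => FracPLap.levelSlice_le _ _) hvA
  have hvE : FracPLap.energy p s v < ∞ :=
    (FracPLap.energy_mono_of_abs_le zero_le_one hp0.le (u := u)
      (by simpa using habs)).trans_lt (ENNReal.mul_lt_top ENNReal.ofReal_lt_top huE)
  have hvv : FracPLap.VanishesAtInfinity v := fun a ha => by
    refine (measure_mono fun x hx => ?_).trans_lt (hu0 h hh0)
    by_contra hcon
    have hcon : |u x| ≤ h := not_lt.1 hcon
    have hx : a < |FracPLap.levelSlice h (u x)| := hx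
    rw [FracPLap.levelSlice_of_le ((le_abs_self _).trans hcon) hh0.le, abs_zero] at hx
    linarith
  have hEle := (FracPLap.energy_toReal_le_of_hasDerivAt hp hvm huE hsign habs
    (htest v ⟨hvm, hvv, hvE⟩ hint)).trans hle
  have hsob' := hsob A v hA0 hvm hv0 hvA
  rw [ENNReal.ofReal_le_iff_le_toReal hvE.ne] at hsob'
  have := FracPLap.two_mul_le_of_rpow_bound hp hn hs0 hpq hq0 rfl hr hqτ hc hw0
    ENNReal.toReal_nonneg hh0 hR hAlow (hsob'.trans hEle)
  rwa [show 2 * h = U R by rw [hh]; ring] at this
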